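/- Setting. Let $E$ be a measurable space. For a measurable $\psi:E\to(0,+\infty)$, let $L^\infty(\psi)$ be the space of measurable $f:E\to\mathbb R$ such that $|f|/\psi$ is bounded. A positive semigroup on $L^\infty(\psi)$ is a family $(P_n)_{n\in\mathbb Z_+}$ of linear maps from $L^\infty(\psi)$ to itself that send non-negative functions to non-negative functions and satisfy $P_0=\mathrm{Id}$ and $P_{m+n}=P_mP_n$ for all $m,n\geq 0$. Condition (G). Let $\psi_1:E\to(0,+\infty)$ be measurable, let $(P_n)$ be a positive semigroup on $L^\infty(\psi_1)$, and let $\psi_2\in L^\infty(\psi_1)$ be non-negative. Condition (G) holds with $\psi_1,\psi_2$ if there exist real constants $\theta_1,\theta_2,c_1,c_2,c_3>0$, an integer $n_1\ge 1$, a measurable set $K\subset E$ and a probability measure $\nu$ on $K$ such that - (G1) for all $x\in K$ and all measurable $A\subset K$, $P_{n_1}(\psi_1\mathbf 1_A)(x)\ge c_1\,\nu(A)\,\psi_1(x)$; - (G2) $\theta_1<\theta_2$, $\ \inf_{x\in K}\psi_2(x)/\psi_1(x)>0$, $\ \sup_{x\in E}\psi_2(x)/\psi_1(x)\le 1$, and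 for all $x\in E$, $P_1\psi_1(x)\le\theta_1\psi_1(x)+c_2\mathbf 1_K(x)\psi_1(x)$ and $P_1\psi_2(x)\ge\theta_2\psi_2(x)$; - (G3) $\displaystyle\sup_{n\in\mathbb Z_+}\frac{\sup_{y\in K}P_n\psi_1(y)/\psi_1(y)}{\inf_{y\in K}P_n\psi_1(y)/\psi_1(y)}\le c_3$; - (G4) for all $x\in K$ there exists $n_4(x)$ such that $P_n(\mathbf 1_K\psi_1)(x)>0$ for all $n\ge n_4(x)$. Theorem 2.2. Let $\psi:E\to(0,+\infty)$ be measurable and let $(P_n)_{n\in\mathbb Z_+}$ be a positive semigroup on $L^\infty(\psi)$. Assume that there exist a real number $\theta_0>0$, a non-negative function $\eta\in L^\infty(\psi)$, not identically zero (but allowed to vanish at some points), with $P_1\eta=\theta_0\eta$, a positive measure $\nu_P$ on $E$ with $\nu_P(\psi)<+\infty$, and a sequence $(\zeta_n)_{n\ge0}$ of positive real numbers converging to $0$ such that $$\left|\theta_0^{-n}P_nf(x)-\eta(x)\nu_P(f)\right|\le\zeta_n\,\psi(x)$$ for all $n\geq 0$, all $x\in E$ and all measurable $f:E\to\mathbb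 R$ with $|f|\le\psi$, where $\nu_P(f)=\int_E f\,d\nu_P$. Then there exists a measurable function $\psi_1:E\to(0,+\infty)$ with $\psi_1\in L^\infty(\psi)$ and $\psi\in L^\infty(\psi_1)$ (so that $L^\infty(\psi_1)=L^\infty(\psi)$) such that $(P_n)$ satisfies Condition (G) with this $\psi_1$ and with $\psi_2=\eta$. -/

import Mathlib

open MeasureTheory Filter Topology
open scoped ENNReal

/-- The space `L^∞(ψ)` of measurable functions `f : E → ℝ` such that `|f| / ψ` is bounded
(it is only used for weights `ψ` with values in `(0, +∞)`). -/
def LInftyWeight {E : Type*} [MeasurableSpace E] (ψ : E → ℝ) : Set (E → ℝ) :=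
  {f | Measurable f ∧ ∃ C : ℝ, ∀ x, |f x| / ψ x ≤ C}

/-- `(P n)` is a positive semigroup of linear operators from `L^∞(ψ)` to itself, for a measurable
weight `ψ : E → (0, +∞)`. Each `P n` is written as a map on all functions, but nothing is assumed
about its values outside `L^∞(ψ)`. -/
structure IsPositiveSemigroup {E : Type*} [MeasurableSpace E] (ψ : E → ℝ)
    (P : ℕ → (E → ℝ) → (E → ℝ)) : Prop where
  measurable_weight : Measurable ψ
  weight_pos : ∀ x, 0 < ψ x
  mapsTo : ∀ n, ∀ f ∈ LInftyWeight ψ, P n f ∈ LInftyWeight ψ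
  map_add : ∀ n, ∀ f ∈ LInftyWeight ψ, ∀ g ∈ LInftyWeight ψ, P n (f + g) = P n f + P n g
  map_smul : ∀ n (a : ℝ), ∀ f ∈ LInftyWeight ψ, P n (a • f) = a • P n f
  nonneg : ∀ n, ∀ f ∈ LInftyWeight ψ, (∀ x, 0 ≤ f x) → ∀ x, 0 ≤ P n f x
  zero : ∀ f ∈ LInftyWeight ψ, P 0 f = f
  add : ∀ m n, ∀ f ∈ LInftyWeight ψ, P (m + n) f = P m (P n f)

/-- Condition (G) for the semigroup `(P n)` with the two functions `ψ₁ : E → (0, +∞)` and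
`ψ₂ : E → [0, +∞)`. It includes the setting in which the condition is stated: `(P n)` is a positive
semigroup on `L^∞(ψ₁)`, and `ψ₂` belongs to this space. The infima and suprema are taken in
`[0, +∞]`. -/
def ConditionG {E : Type*} [MeasurableSpace E] (P : ℕ → (E → ℝ) → (E → ℝ))
    (ψ₁ ψ₂ : E → ℝ) : Prop :=
  IsPositiveSemigroup ψ₁ P ∧ ψ₂ ∈ LInftyWeight ψ₁ ∧ (∀ x, 0 ≤ ψ₂ x) ∧
  ∃ (θ₁ θ₂ c₁ c₂ c₃ : ℝ) (n₁ : ℕ) (K : Set E) (ν : Measure E),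
    0 < θ₁ ∧ 0 < θ₂ ∧ 0 < c₁ ∧ 0 < c₂ ∧ 0 < c₃ ∧ 1 ≤ n₁ ∧
    MeasurableSet K ∧ IsProbabilityMeasure ν ∧ ν Kᶜ = 0 ∧
    -- (G1) local Dobrushin coefficient
    (∀ x ∈ K, ∀ A : Set E, MeasurableSet A → A ⊆ K →
      c₁ * ν.real A * ψ₁ x ≤ P n₁ (A.indicator ψ₁) x) ∧
    -- (G2) global Lyapunov criterion
    (θ₁ < θ₂ ∧
      0 < (⨅ x ∈ K, ENNReal.ofReal (ψ₂ x / ψ₁ x)) ∧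
      (⨆ x, ENNReal.ofReal (ψ₂ x / ψ₁ x)) ≤ 1 ∧
      (∀ x, P 1 ψ₁ x ≤ θ₁ * ψ₁ x + c₂ * K.indicator ψ₁ x) ∧
      (∀ x, θ₂ * ψ₂ x ≤ P 1 ψ₂ x)) ∧
    -- (G3) local Harnack inequality
    (⨆ n : ℕ, (⨆ y ∈ K, ENNReal.ofReal (P n ψ₁ y / ψ₁ y)) /
        (⨅ y ∈ K, ENNReal.ofReal (P n ψ₁ y / ψ₁ y))) ≤ ENNReal.ofReal c₃ ∧
    -- (G4) aperiodicity
    (∀ x ∈ K, ∃ n₄ : ℕ, ∀ n ≥ n₄, 0 < P n (K.indicator ψ₁) x)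

/-!
Put `Q n = θ₀⁻ⁿ P n`. The hypothesis says that `Q n` converges, in the operator norm of `L^∞(ψ)`,
to the rank-one operator `f ↦ π(f) η` with `π = νP`; necessarily `π(η) = 1`
(`integral_eigenfunction_eq_one`).

*Lyapunov function.* If `b > 1` and `b ^ m` times the error at time `m` is at most `1`, then
`φ = ∑ k < m, b ^ k Q k ψ` satisfies `Q 1 φ ≤ b⁻¹ φ + D η` (`exists_lyapunov_function`). A multiple
`ψ₁` of `φ` dominates both `η` and `ψ`, and for small `δ` the function `ψ₁` is contracted by `Q 1`
outside `K = {δ ψ₁ ≤ η}`, while `π(ψ 1_K) > 0`. On `K`, `Q n ψ₁ ≥ Q n η = η ≥ δ ψ₁`, which gives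
the Harnack inequality (G3), and (G4) follows from `Q n (ψ 1_K) → η π(ψ 1_K)`.

*Minorization.* The delicate condition is (G1), since the convergence says nothing about
`Q n (ψ 1_A)` when `π(ψ 1_A)` is below the error, the σ-algebra need not be countably generated, and
the `Q n` need not be given by kernels. The measure `ν` is the infimum over `x ∈ K` of the finitely
additive set functions `A ↦ Q (2 n) (ψ 1_A) x / ψ x`, which is a measure by Carathéodory's
criterion (`exists_measure_le_of_superadditive`). It has positive mass if
`∑ i, Q (2 n) (ψ 1_{A i}) (x i) / ψ (x i)` is bounded below for all countable partitions `A` of `K`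
and all points `x i ∈ K`. With `a i = π(ψ 1_{A i})`, apply `Q n` to the truncated functions
`g i = min (Q n (ψ 1_{A i})) (a i η)`: pointwise `∑ i, (a i η - g i)` is at most the error of
`Q n` on a single test function, and since `g i ≤ a i η`, the errors of the second step sum to a
multiple of `∑ i, a i = π(ψ 1_K)` (`sum_indicator_lower_bound`).
-/

/-! ### Weighted spaces and positive semigroups -/

lemma abs_indicator_le_weight {E : Type*} {ψ : E → ℝ} (hψ : ∀ x, 0 < ψ x) (A : Set E) (x : E) :
    |A.indicator ψ x| ≤ ψ x := by
  rw [abs_of_nonneg (Set.indicator_nonneg (fun y _ => (hψ y).le) x)]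
  exact Set.indicator_le_self' (fun y _ => (hψ y).le) x

section WeightedSpace

variable {E : Type*} [MeasurableSpace E] {ψ f g : E → ℝ}

lemma mem_LInftyWeight_of_abs_le (hψ : ∀ x, 0 < ψ x) (hf : Measurable f) {C : ℝ}
    (h : ∀ x, |f x| ≤ C * ψ x) : f ∈ LInftyWeight ψ :=
  ⟨hf, C, fun x => (div_le_iff₀ (hψ x)).2 (h x)⟩

lemma exists_abs_le_of_mem_LInftyWeight (hψ : ∀ x, 0 < ψ x) (hf : f ∈ LInftyWeight ψ) :
    ∃ C : ℝ, 0 < C ∧ ∀ x, |f x| ≤ C * ψ x := by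
  obtain ⟨-, C, hC⟩ := hf
  refine ⟨max C 1, lt_max_of_lt_right one_pos, fun x => ?_⟩
  exact (div_le_iff₀ (hψ x)).1 ((hC x).trans (le_max_left _ _))

lemma LInftyWeight_add_mem (hf : f ∈ LInftyWeight ψ)
    (hg : g ∈ LInftyWeight ψ) (hψ : ∀ x, 0 < ψ x) : f + g ∈ LInftyWeight ψ := by
  obtain ⟨C, -, hC⟩ := exists_abs_le_of_mem_LInftyWeight hψ hf
  obtain ⟨D, -, hD⟩ := exists_abs_le_of_mem_LInftyWeight hψ hg
  refine mem_LInftyWeight_of_abs_le hψ (hf.1.add hg.1) (C := C + D) fun x => ?_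
  have := abs_add_le (f x) (g x)
  simp only [Pi.add_apply]
  linarith [hC x, hD x]

lemma LInftyWeight_smul_mem (hf : f ∈ LInftyWeight ψ) (a : ℝ) (hψ : ∀ x, 0 < ψ x) :
    a • f ∈ LInftyWeight ψ := by
  obtain ⟨C, -, hC⟩ := exists_abs_le_of_mem_LInftyWeight hψ hf
  refine mem_LInftyWeight_of_abs_le hψ (hf.1.const_smul a) (C := |a| * C) fun x => ?_
  simp only [Pi.smul_apply, smul_eq_mul, abs_mul, mul_assoc]
  exact mul_le_mul_of_nonneg_left (hC x) (abs_nonneg a)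

lemma zero_mem_LInftyWeight (ψ : E → ℝ) : (0 : E → ℝ) ∈ LInftyWeight ψ :=
  ⟨measurable_zero, 0, fun x => by simp⟩

lemma LInftyWeight_sum_mem {ι : Type*} (s : Finset ι) {F : ι → E → ℝ}
    (hF : ∀ i ∈ s, F i ∈ LInftyWeight ψ) (hψ : ∀ x, 0 < ψ x) :
    ∑ i ∈ s, F i ∈ LInftyWeight ψ :=
  Finset.sum_induction _ (· ∈ LInftyWeight ψ) (fun _ _ ha hb => LInftyWeight_add_mem ha hb hψ)
    (zero_mem_LInftyWeight ψ) hF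

lemma LInftyWeight_subset_of_mem {φ : E → ℝ} (hψ : ∀ x, 0 < ψ x) (hφ : ∀ x, 0 < φ x)
    (h : φ ∈ LInftyWeight ψ) : LInftyWeight φ ⊆ LInftyWeight ψ := by
  intro f hf
  obtain ⟨C, hC0, hC⟩ := exists_abs_le_of_mem_LInftyWeight hφ hf
  obtain ⟨D, -, hD⟩ := exists_abs_le_of_mem_LInftyWeight hψ h
  refine mem_LInftyWeight_of_abs_le hψ hf.1 (C := C * D) fun x => (hC x).trans ?_
  rw [mul_assoc]
  exact mul_le_mul_of_nonneg_left ((le_abs_self _).trans (hD x)) hC0.le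

lemma integrable_of_mem_LInftyWeight {μ : Measure E} (hψ : ∀ x, 0 < ψ x)
    (hμ : Integrable ψ μ) (hf : f ∈ LInftyWeight ψ) : Integrable f μ := by
  obtain ⟨C, -, hC⟩ := exists_abs_le_of_mem_LInftyWeight hψ hf
  exact (hμ.const_mul C).mono' hf.1.aestronglyMeasurable (ae_of_all _ hC)

end WeightedSpace

namespace IsPositiveSemigroup

variable {E : Type*} [MeasurableSpace E] {ψ : E → ℝ} {P : ℕ → (E → ℝ) → (E → ℝ)}

lemma weight_mem (hP : IsPositiveSemigroup ψ P) : ψ ∈ LInftyWeight ψ :=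
  mem_LInftyWeight_of_abs_le hP.weight_pos hP.measurable_weight (C := 1)
    fun x => by rw [abs_of_pos (hP.weight_pos x), one_mul]

lemma indicator_mem (hP : IsPositiveSemigroup ψ P) {A : Set E} (hA : MeasurableSet A) :
    A.indicator ψ ∈ LInftyWeight ψ :=
  mem_LInftyWeight_of_abs_le hP.weight_pos (hP.measurable_weight.indicator hA) (C := 1)
    fun x => by simpa using abs_indicator_le_weight hP.weight_pos A x

lemma map_zero_fun (hP : IsPositiveSemigroup ψ P) (n : ℕ) : P n 0 = 0 := by
  simpa using hP.map_smul n 0 0 (zero_mem_LInftyWeight ψ)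

lemma map_sum (hP : IsPositiveSemigroup ψ P) (n : ℕ) {ι : Type*} (s : Finset ι)
    {F : ι → E → ℝ} (hF : ∀ i ∈ s, F i ∈ LInftyWeight ψ) :
    P n (∑ i ∈ s, F i) = ∑ i ∈ s, P n (F i) := by
  classical
  induction s using Finset.induction_on with
  | empty => simpa using hP.map_zero_fun n
  | insert a s ha ih =>
    rw [Finset.sum_insert ha, Finset.sum_insert ha, hP.map_add n _ (hF a (by simp)) _
      (LInftyWeight_sum_mem s (fun i hi => hF i (by simp [hi])) hP.weight_pos),
      ih fun i hi => hF i (by simp [hi])]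

lemma mono (hP : IsPositiveSemigroup ψ P) (n : ℕ) {f g : E → ℝ} (hf : f ∈ LInftyWeight ψ)
    (hg : g ∈ LInftyWeight ψ) (hfg : ∀ x, f x ≤ g x) (x : E) : P n f x ≤ P n g x := by
  have hd : (-1 : ℝ) • f ∈ LInftyWeight ψ := LInftyWeight_smul_mem hf _ hP.weight_pos
  have h := hP.nonneg n (g + (-1 : ℝ) • f) (LInftyWeight_add_mem hg hd hP.weight_pos)
    (fun y => by have := hfg y; simp; linarith) x
  rw [hP.map_add n _ hg _ hd, hP.map_smul n _ _ hf] at h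
  simp at h
  linarith

/-- A positive semigroup on `L^∞(ψ)` is one on `L^∞(φ)` when the weights are comparable. -/
lemma of_comparable (hP : IsPositiveSemigroup ψ P) {φ : E → ℝ} (hφ : ∀ x, 0 < φ x)
    (h₁ : φ ∈ LInftyWeight ψ) (h₂ : ψ ∈ LInftyWeight φ) : IsPositiveSemigroup φ P := by
  have h : LInftyWeight φ = LInftyWeight ψ :=
    (LInftyWeight_subset_of_mem hP.weight_pos hφ h₁).antisymm
      (LInftyWeight_subset_of_mem hφ hP.weight_pos h₂)
  refine ⟨h₁.1, hφ, ?_, ?_, ?_, ?_, ?_, ?_⟩ <;> rw [h]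
  exacts [hP.mapsTo, hP.map_add, hP.map_smul, hP.nonneg, hP.zero, hP.add]

lemma normalize (hP : IsPositiveSemigroup ψ P) {θ : ℝ} (hθ : 0 < θ) :
    IsPositiveSemigroup ψ fun n f => (θ ^ n)⁻¹ • P n f where
  measurable_weight := hP.measurable_weight
  weight_pos := hP.weight_pos
  mapsTo n f hf := LInftyWeight_smul_mem (hP.mapsTo n f hf) _ hP.weight_pos
  map_add n f hf g hg := by rw [hP.map_add n f hf g hg, smul_add]
  map_smul n a f hf := by rw [hP.map_smul n a f hf, smul_comm]
  nonneg n f hf h x := mul_nonneg (by positivity) (hP.nonneg n f hf h x)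
  zero f hf := by simp [hP.zero f hf]
  add m n f hf := by
    rw [hP.add m n f hf, hP.map_smul m _ _ (hP.mapsTo n f hf), smul_smul, pow_add, mul_inv]

lemma map_eigenfunction (hP : IsPositiveSemigroup ψ P) {η : E → ℝ} (hη : η ∈ LInftyWeight ψ)
    (h : P 1 η = η) (n : ℕ) : P n η = η := by
  induction n with
  | zero => exact hP.zero η hη
  | succ n ih => rw [hP.add n 1 η hη, h, ih]

end IsPositiveSemigroup

/-! ### Measures below a family of finitely additive set functions -/

/-- The infimum of a family of finitely additive set functions `q i`, taken over countable
measurable partitions, is a measure. The `q i` need not be countably additive: Carathéodory's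
criterion for the outer measure generated by `t ↦ ⨅ i, q i t` only uses superadditivity. -/
lemma exists_measure_le_of_superadditive {E ι : Type*} [MeasurableSpace E] [Nonempty ι]
    (q : ι → Set E → ℝ≥0∞) (hq_empty : ∀ i, q i ∅ = 0)
    (hq_add : ∀ i A B, MeasurableSet A → MeasurableSet B → Disjoint A B →
      q i A + q i B ≤ q i (A ∪ B))
    (c : ℝ≥0∞)
    (hc : ∀ (A : ℕ → Set E) (i : ℕ → ι), (∀ n, MeasurableSet (A n)) →
      Pairwise (Function.onFun Disjoint A) → ⋃ n, A n = Set.univ → c ≤ ∑' n, q (i n) (A n)) :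
    ∃ ν : Measure E, c ≤ ν Set.univ ∧ ∀ i A, MeasurableSet A → ν A ≤ q i A := by
  have hq_mono : ∀ i A B, MeasurableSet A → MeasurableSet B → A ⊆ B → q i A ≤ q i B := by
    intro i A B hA hB hAB
    have h := hq_add i A (B \ A) hA (hB.diff hA) Set.disjoint_sdiff_right
    rw [Set.union_sdiff_cancel hAB] at h
    exact le_self_add.trans h
  -- Outer approximation by measurable sets extends the infimum to all sets.
  let m : Set E → ℝ≥0∞ := fun t => ⨅ p : ι × {A : Set E // MeasurableSet A ∧ t ⊆ A}, q p.1 p.2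
  have hm_le : ∀ i A, MeasurableSet A → m A ≤ q i A := fun i A hA =>
    iInf_le (fun p : ι × {B : Set E // MeasurableSet B ∧ A ⊆ B} => q p.1 p.2)
      (i, ⟨A, hA, subset_rfl⟩)
  have hm_empty : m ∅ = 0 := by
    obtain ⟨i⟩ := ‹Nonempty ι›
    exact le_antisymm ((hm_le i ∅ .empty).trans (hq_empty i).le) zero_le
  have hle : (‹MeasurableSpace E› : MeasurableSpace E) ≤
      (OuterMeasure.ofFunction m hm_empty).caratheodory := by
    intro s hs
    refine OuterMeasure.ofFunction_caratheodory fun t => le_iInf ?_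
    rintro ⟨i, A, hA, htA⟩
    calc m (t ∩ s) + m (t \ s) ≤ q i (A ∩ s) + q i (A \ s) := by
          gcongr
          · exact iInf_le_of_le (i, ⟨A ∩ s, hA.inter hs, by gcongr⟩) le_rfl
          · exact iInf_le_of_le (i, ⟨A \ s, hA.diff hs, by gcongr⟩) le_rfl
      _ ≤ q i (A ∩ s ∪ A \ s) :=
          hq_add i _ _ (hA.inter hs) (hA.diff hs) Set.disjoint_sdiff_inter.symm
      _ = q i A := by rw [Set.inter_union_sdiff]
  refine ⟨(OuterMeasure.ofFunction m hm_empty).toMeasure hle, ?_, fun i A hA => ?_⟩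
  · rw [toMeasure_apply _ hle .univ, OuterMeasure.ofFunction_apply]
    refine le_iInf₂ fun t ht => ENNReal.le_of_forall_pos_le_add fun ε hε hfin => ?_
    obtain ⟨ε', hε'_pos, hε'⟩ :=
      ENNReal.exists_pos_sum_of_countable (ENNReal.coe_pos.2 hε).ne' ℕ
    have hchoose : ∀ n, ∃ p : ι × {A : Set E // MeasurableSet A ∧ t n ⊆ A},
        q p.1 p.2 < m (t n) + ε' n := fun n =>
      iInf_lt_iff.1 (ENNReal.lt_add_right
        (ne_top_of_le_ne_top hfin.ne (ENNReal.le_tsum n)) (by simpa using (hε'_pos n).ne'))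
    choose p hp using hchoose
    let A : ℕ → Set E := fun n => (p n).2
    have hA : ∀ n, MeasurableSet (A n) := fun n => (p n).2.2.1
    have hcov : ⋃ n, disjointed A n = Set.univ := by
      rw [iUnion_disjointed]
      exact Set.univ_subset_iff.1 (ht.trans (Set.iUnion_mono fun n => (p n).2.2.2))
    calc c ≤ ∑' n, q (p n).1 (disjointed A n) :=
          hc _ _ (fun n => MeasurableSet.disjointed hA n) (disjoint_disjointed A) hcov
      _ ≤ ∑' n, (m (t n) + ε' n) := ENNReal.tsum_le_tsum fun n =>
          (hq_mono _ _ _ (MeasurableSet.disjointed hA n) (hA n) (disjointed_subset A n)).trans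
            (hp n).le
      _ ≤ ∑' n, m (t n) + ε := by
          rw [ENNReal.tsum_add]
          gcongr
  · rw [toMeasure_apply _ hle hA]
    exact (OuterMeasure.ofFunction_le A).trans (hm_le i A hA)

/-! ### Operators close to a rank-one operator -/

/-- `T` is within `ε` of the rank-one operator `f ↦ π(f) η`, in the operator norm associated
with the weighted supremum norm of `L^∞(ψ)`. -/
def IsRankOneApprox {E : Type*} [MeasurableSpace E] (ψ η : E → ℝ) (π : Measure E)
    (T : (E → ℝ) → (E → ℝ)) (ε : ℝ) : Prop :=
  ∀ f : E → ℝ, Measurable f → (∀ x, |f x| ≤ ψ x) →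
    ∀ x, |T f x - η x * ∫ y, f y ∂π| ≤ ε * ψ x

section RankOne

variable {E : Type*} [MeasurableSpace E] {ψ η : E → ℝ} {π : Measure E}
  {Q : ℕ → (E → ℝ) → (E → ℝ)}

lemma IsRankOneApprox.scaled (hQ : IsPositiveSemigroup ψ Q) {n : ℕ} {ε : ℝ}
    (h : IsRankOneApprox ψ η π (Q n) ε) {f : E → ℝ} (hf : Measurable f) {C : ℝ} (hC : 0 < C)
    (hfC : ∀ x, |f x| ≤ C * ψ x) (x : E) :
    |Q n f x - η x * ∫ y, f y ∂π| ≤ C * ε * ψ x := by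
  have h1 := h (C⁻¹ • f) (hf.const_smul _) (fun y => by
    rw [Pi.smul_apply, smul_eq_mul, abs_mul, abs_of_pos (inv_pos.2 hC), inv_mul_le_iff₀ hC]
    exact hfC y) x
  have hmem : f ∈ LInftyWeight ψ := mem_LInftyWeight_of_abs_le hQ.weight_pos hf hfC
  rw [hQ.map_smul n _ _ hmem] at h1
  simp only [Pi.smul_apply, smul_eq_mul, integral_const_mul] at h1
  have e : C⁻¹ * Q n f x - η x * (C⁻¹ * ∫ y, f y ∂π) =
      C⁻¹ * (Q n f x - η x * ∫ y, f y ∂π) := by ring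
  rw [e, abs_mul, abs_of_pos (inv_pos.2 hC), inv_mul_le_iff₀ hC] at h1
  linarith

/-- The limit functional is normalised on the eigenfunction: both are fixed by the limit. -/
lemma integral_eigenfunction_eq_one (hQ : IsPositiveSemigroup ψ Q) (hη : η ∈ LInftyWeight ψ)
    (hη_ne : η ≠ 0) (hfix : Q 1 η = η) {ζ : ℕ → ℝ} (hζ : Tendsto ζ atTop (𝓝 0))
    (hconv : ∀ n, IsRankOneApprox ψ η π (Q n) (ζ n)) : ∫ y, η y ∂π = 1 := by
  obtain ⟨C, hC0, hC⟩ := exists_abs_le_of_mem_LInftyWeight hQ.weight_pos hη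
  obtain ⟨x, hx⟩ := Function.ne_iff.1 hη_ne
  have hlim : Tendsto (fun n => C * ζ n * ψ x) atTop (𝓝 0) := by
    simpa using (hζ.const_mul C).mul_const (ψ x)
  have h0 : |η x - η x * ∫ y, η y ∂π| ≤ 0 := ge_of_tendsto' hlim fun n => by
    simpa [hQ.map_eigenfunction hη hfix n] using (hconv n).scaled hQ hη.1 hC0 hC x
  have h1 := abs_nonpos_iff.1 h0
  have h2 : η x * (1 - ∫ y, η y ∂π) = 0 := by linarith
  rcases mul_eq_zero.1 h2 with h | h
  · exact absurd h hx
  · linarith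

/-! ### Minorization -/

/-- Quantitative core of the minorization. Truncating `f i = Q n (ψ 1_{A i})` at its expected
value `η π(ψ 1_{A i})` costs little in total, because for each point the deficient indices `i`
merge into a single test function `ψ 1_B`; and the truncated functions are small enough for the
errors of the second step `Q n` to add up to a multiple of `∑ i, π(ψ 1_{A i})`. -/
lemma sum_indicator_lower_bound (hQ : IsPositiveSemigroup ψ Q) (hπ : Integrable ψ π)
    (hη : Measurable η) (hη0 : ∀ x, 0 ≤ η x) {C : ℝ} (hC0 : 0 < C) (hC : ∀ x, η x ≤ C * ψ x)
    (hη1 : ∫ y, η y ∂π = 1) {n : ℕ} {ε : ℝ}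
    (h : IsRankOneApprox ψ η π (Q n) ε) {δ : ℝ} (hδ : 0 < δ)
    {ι : Type*} (s : Finset ι) (A : ι → Set E) (hA : ∀ i, MeasurableSet (A i))
    (hdisj : Pairwise (Function.onFun Disjoint A)) (x : ι → E)
    (hx : ∀ i, δ * ψ (x i) ≤ η (x i)) :
    δ * (∑ i ∈ s, ∫ y in A i, ψ y ∂π - ε * ∫ y, ψ y ∂π)
        - ε * C * ∑ i ∈ s, ∫ y in A i, ψ y ∂π
      ≤ ∑ i ∈ s, Q (n + n) ((A i).indicator ψ) (x i) / ψ (x i) := by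
  classical
  have hψ := hQ.weight_pos
  set a : ι → ℝ := fun i => ∫ y in A i, ψ y ∂π with ha
  have ha0 : ∀ i, 0 ≤ a i := fun i => integral_nonneg fun y => (hψ y).le
  set f : ι → E → ℝ := fun i => Q n ((A i).indicator ψ) with hf
  have hf_mem : ∀ i, f i ∈ LInftyWeight ψ := fun i => hQ.mapsTo n _ (hQ.indicator_mem (hA i))
  have hf0 : ∀ i y, 0 ≤ f i y := fun i =>
    hQ.nonneg n _ (hQ.indicator_mem (hA i)) (Set.indicator_nonneg fun y _ => (hψ y).le)
  set g : ι → E → ℝ := fun i y => min (f i y) (η y * a i) with hg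
  have hg0 : ∀ i y, 0 ≤ g i y := fun i y => le_min (hf0 i y) (mul_nonneg (hη0 y) (ha0 i))
  have hg_meas : ∀ i, Measurable (g i) := fun i => (hf_mem i).1.min (hη.mul_const _)
  have hg_le : ∀ i y, |g i y| ≤ C * a i * ψ y := fun i y => by
    rw [abs_of_nonneg (hg0 i y)]
    calc g i y ≤ η y * a i := min_le_right _ _
      _ ≤ C * ψ y * a i := mul_le_mul_of_nonneg_right (hC y) (ha0 i)
      _ = C * a i * ψ y := by ring
  have hg_mem : ∀ i, g i ∈ LInftyWeight ψ := fun i =>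
    mem_LInftyWeight_of_abs_le hψ (hg_meas i) (hg_le i)
  have hη_mem : η ∈ LInftyWeight ψ := mem_LInftyWeight_of_abs_le hψ hη (C := C) fun y => by
    rw [abs_of_nonneg (hη0 y)]
    exact hC y
  have hη_int : Integrable η π := integrable_of_mem_LInftyWeight hψ hπ hη_mem
  have hg_int : ∀ i, Integrable (g i) π := fun i =>
    integrable_of_mem_LInftyWeight hψ hπ (hg_mem i)
  -- Total loss caused by the truncation, at a given point.
  have hloss : ∀ y, ∑ i ∈ s, (η y * a i - g i y) ≤ ε * ψ y := fun y => by
    set B := s.filter fun i => f i y < η y * a i with hB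
    have e1 : ∑ i ∈ s, (η y * a i - g i y) = ∑ i ∈ B, (η y * a i - f i y) := by
      rw [hB, Finset.sum_filter]
      refine Finset.sum_congr rfl fun i _ => ?_
      split_ifs with hi
      · simp only [hg, min_eq_left hi.le]
      · simp only [hg, min_eq_right (not_lt.1 hi), sub_self]
    have e2 : ∑ i ∈ B, (A i).indicator ψ = (⋃ i ∈ B, A i).indicator ψ := by
      rw [Finset.indicator_biUnion B A fun i _ j _ hij => hdisj hij]
      ext z
      simp
    have hU : MeasurableSet (⋃ i ∈ B, A i) := Finset.measurableSet_biUnion B fun i _ => hA i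
    have e3 : ∑ i ∈ B, f i y = Q n ((⋃ i ∈ B, A i).indicator ψ) y := by
      rw [← e2, hQ.map_sum n B fun i _ => hQ.indicator_mem (hA i), Finset.sum_apply]
    have e4 : ∑ i ∈ B, a i = ∫ z, (⋃ i ∈ B, A i).indicator ψ z ∂π := by
      rw [← e2]
      simp only [Finset.sum_apply]
      rw [integral_finsetSum _ fun i _ => hπ.indicator (hA i)]
      exact Finset.sum_congr rfl fun i _ => (integral_indicator (hA i)).symm
    have h1 := h _ (hQ.measurable_weight.indicator hU) (abs_indicator_le_weight hψ _) y
    rw [e1, Finset.sum_sub_distrib, ← Finset.mul_sum, e3, e4]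
    linarith [neg_abs_le (Q n ((⋃ i ∈ B, A i).indicator ψ) y -
      η y * ∫ z, (⋃ i ∈ B, A i).indicator ψ z ∂π)]
  have hd_int : ∀ i, Integrable (fun y => η y * a i - g i y) π := fun i =>
    (hη_int.mul_const _).sub (hg_int i)
  have hg_sum : ∑ i ∈ s, a i - ε * ∫ y, ψ y ∂π ≤ ∑ i ∈ s, ∫ y, g i y ∂π := by
    have h1 : ∫ y, ∑ i ∈ s, (η y * a i - g i y) ∂π ≤ ∫ y, ε * ψ y ∂π :=
      integral_mono (integrable_finsetSum _ fun i _ => hd_int i)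
        (hπ.const_mul ε) hloss
    rw [integral_finsetSum _ fun i _ => hd_int i,
      integral_const_mul] at h1
    have h2 : ∀ i ∈ s, ∫ y, (η y * a i - g i y) ∂π = a i - ∫ y, g i y ∂π := fun i _ => by
      rw [integral_sub (hη_int.mul_const _) (hg_int i), integral_mul_const, hη1, one_mul]
    rw [Finset.sum_congr rfl h2, Finset.sum_sub_distrib] at h1
    linarith
  have hterm : ∀ i ∈ s, δ * ∫ y, g i y ∂π - ε * C * a i
      ≤ Q (n + n) ((A i).indicator ψ) (x i) / ψ (x i) := fun i _ => by
    have hint0 : 0 ≤ ∫ y, g i y ∂π := integral_nonneg (hg0 i)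
    rw [le_div_iff₀ (hψ _), hQ.add n n _ (hQ.indicator_mem (hA i))]
    refine le_trans ?_ (hQ.mono n (hg_mem i) (hf_mem i) (fun y => min_le_left _ _) (x i))
    -- The degenerate case `a i = 0`, where `g i = 0`, is excluded from the rescaling.
    rcases (ha0 i).eq_or_lt with h0 | hpos
    · have hz : g i = 0 := funext fun y => abs_nonpos_iff.1 (by simpa [← h0] using hg_le i y)
      simp [hz, ← h0, hQ.map_zero_fun n]
    · have h1 := neg_abs_le (Q n (g i) (x i) - η (x i) * ∫ y, g i y ∂π)
      have h2 := h.scaled hQ (hg_meas i) (mul_pos hC0 hpos) (hg_le i) (x i)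
      have h3 := mul_le_mul_of_nonneg_right (hx i) hint0
      nlinarith
  calc _ ≤ ∑ i ∈ s, (δ * ∫ y, g i y ∂π - ε * C * a i) := by
        rw [Finset.sum_sub_distrib, ← Finset.mul_sum, ← Finset.mul_sum]
        gcongr
    _ ≤ _ := Finset.sum_le_sum hterm

/-- Minorization on `K`: the infimum over `x ∈ K` of the set functions
`A ↦ Q (2 n) (ψ 1_A) x / ψ x` is a nonzero measure as soon as `Q n` is close enough to its
rank-one limit. -/
lemma exists_minorizing_measure (hQ : IsPositiveSemigroup ψ Q) (hπ : Integrable ψ π)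
    (hη : Measurable η) (hη0 : ∀ x, 0 ≤ η x) {C : ℝ} (hC0 : 0 < C) (hC : ∀ x, η x ≤ C * ψ x)
    (hη1 : ∫ y, η y ∂π = 1) {n : ℕ} {ε : ℝ}
    (h : IsRankOneApprox ψ η π (Q n) ε) {δ : ℝ} (hδ : 0 < δ)
    {K : Set E} (hK : MeasurableSet K) (hK_ne : K.Nonempty) (hKδ : ∀ x ∈ K, δ * ψ x ≤ η x)
    (hpos : 0 < δ * (∫ y in K, ψ y ∂π - ε * ∫ y, ψ y ∂π) - ε * C * ∫ y in K, ψ y ∂π) :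
    ∃ (c : ℝ) (ν : Measure E), 0 < c ∧ IsProbabilityMeasure ν ∧ ν Kᶜ = 0 ∧
      ∀ x ∈ K, ∀ A, MeasurableSet A → A ⊆ K →
        c * ν.real A * ψ x ≤ Q (n + n) (A.indicator ψ) x := by
  have hψ := hQ.weight_pos
  have : Nonempty K := hK_ne.to_subtype
  let q : K → Set E → ℝ≥0∞ := fun x A =>
    ENNReal.ofReal (Q (n + n) ((A ∩ K).indicator ψ) x / ψ x)
  have hQ0 : ∀ A, MeasurableSet A → ∀ x : E, 0 ≤ Q (n + n) (A.indicator ψ) x / ψ x :=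
    fun A hA x => div_nonneg (hQ.nonneg _ _ (hQ.indicator_mem hA)
      (Set.indicator_nonneg fun y _ => (hψ y).le) x) (hψ x).le
  have hq_empty : ∀ x, q x ∅ = 0 := fun x => by
    have : (∅ : Set E).indicator ψ = 0 := Set.indicator_empty ψ
    simp [q, this, hQ.map_zero_fun]
  obtain ⟨ν, hν_univ, hν_le⟩ := exists_measure_le_of_superadditive q hq_empty
    (fun x A B hA hB hAB => by
      simp only [q]
      rw [← ENNReal.ofReal_add (hQ0 _ (hA.inter hK) x) (hQ0 _ (hB.inter hK) x),
        Set.union_inter_distrib_right, Set.indicator_union_of_disjoint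
          (hAB.mono Set.inter_subset_left Set.inter_subset_left)]
      have e := hQ.map_add (n + n) _ (hQ.indicator_mem (hA.inter hK)) _
        (hQ.indicator_mem (hB.inter hK))
      rw [← add_div, ← Pi.add_apply, ← e]
      exact le_rfl)
    (ENNReal.ofReal (δ * (∫ y in K, ψ y ∂π - ε * ∫ y, ψ y ∂π) - ε * C * ∫ y in K, ψ y ∂π))
    (fun A x hA hdisj hcov => by
      have hAK : ∀ i, MeasurableSet (A i ∩ K) := fun i => (hA i).inter hK
      have hdisj' : Pairwise (Function.onFun Disjoint fun i => A i ∩ K) := fun i j hij =>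
        (hdisj hij).mono Set.inter_subset_left Set.inter_subset_left
      have hS : HasSum (fun i => ∫ y in A i ∩ K, ψ y ∂π) (∫ y in K, ψ y ∂π) := by
        have := hasSum_integral_iUnion hAK hdisj' hπ.integrableOn
        rwa [← Set.iUnion_inter, hcov, Set.univ_inter] at this
      have hlim := hS.tendsto_sum_nat
      have hlim' := ENNReal.tendsto_ofReal
        ((((hlim.sub_const (ε * ∫ y, ψ y ∂π)).const_mul δ)).sub (hlim.const_mul (ε * C)))
      refine le_of_tendsto' hlim' fun N => ?_
      refine le_trans ?_ (ENNReal.sum_le_tsum (Finset.range N))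
      simp only [q]
      rw [← ENNReal.ofReal_sum_of_nonneg fun i _ => hQ0 _ (hAK i) _]
      exact ENNReal.ofReal_le_ofReal (sum_indicator_lower_bound hQ hπ hη hη0 hC0 hC hη1 h hδ
        _ _ hAK hdisj' (fun i => (x i : E)) fun i => hKδ _ (x i).2))
  have hν_pos : ν Set.univ ≠ 0 := ((ENNReal.ofReal_pos.2 hpos).trans_le hν_univ).ne'
  have hν_fin : ν Set.univ ≠ ∞ := by
    obtain ⟨x⟩ := ‹Nonempty K›
    exact ne_top_of_le_ne_top ENNReal.ofReal_ne_top (hν_le x _ .univ)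
  have hν_compl : ν Kᶜ = 0 := by
    obtain ⟨x⟩ := ‹Nonempty K›
    refine le_antisymm ((hν_le x _ hK.compl).trans ?_) zero_le
    have := hq_empty x
    simp only [q, Set.empty_inter] at this
    simp only [q, Set.compl_inter_self, this, le_refl]
  refine ⟨ν.real Set.univ, (ν Set.univ)⁻¹ • ν, ENNReal.toReal_pos hν_pos hν_fin, ?_, ?_, ?_⟩
  · exact ⟨by simp [ENNReal.inv_mul_cancel hν_pos hν_fin]⟩
  · simp [hν_compl]
  · intro x hx A hA hAK
    have e : ν.real Set.univ * ((ν Set.univ)⁻¹ • ν).real A = ν.real A := by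
      rw [measureReal_ennreal_smul_apply, ENNReal.toReal_inv, Measure.real, ← mul_assoc,
        mul_inv_cancel₀ (ENNReal.toReal_pos hν_pos hν_fin).ne', one_mul]
    rw [e, ← le_div_iff₀ (hψ x)]
    have := hν_le ⟨x, hx⟩ A hA
    simp only [q, Set.inter_eq_self_of_subset_left hAK] at this
    exact ENNReal.toReal_le_of_le_ofReal (hQ0 A hA x) this

/-! ### Lyapunov function -/

/-- Geometric sums `∑ k < m, b ^ k Q k ψ` are Lyapunov functions up to a multiple of `η`: applying
`Q 1` shifts the sum, and the new term `b ^ m Q m ψ` is at most `ψ` plus a multiple of `η` when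
`b ^ m` times the distance of `Q m` to its rank-one limit is at most `1`. -/
lemma exists_lyapunov_function (hQ : IsPositiveSemigroup ψ Q)
    {ζ : ℕ → ℝ} (hζ : Tendsto ζ atTop (𝓝 0))
    (hη0 : ∀ x, 0 ≤ η x) (hconv : ∀ n, IsRankOneApprox ψ η π (Q n) (ζ n)) :
    ∃ (φ : E → ℝ) (a D : ℝ), φ ∈ LInftyWeight ψ ∧ (∀ x, ψ x ≤ φ x) ∧ 0 < a ∧ a < 1 ∧ 0 < D ∧
      ∀ x, Q 1 φ x ≤ a * φ x + D * η x := by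
  have hψ := hQ.weight_pos
  set M := ∫ y, ψ y ∂π
  have hM : 0 ≤ M := integral_nonneg fun y => (hψ y).le
  obtain ⟨m, hm, hm1⟩ := ((hζ.eventually_lt_const one_pos).and (eventually_ge_atTop 1)).exists
  obtain ⟨b, hb, hb1⟩ : ∃ b : ℝ, b ^ m * ζ m < 1 ∧ 1 < b := by
    have hcont : Tendsto (fun b : ℝ => b ^ m * ζ m) (𝓝[>] 1) (𝓝 (1 ^ m * ζ m)) :=
      ((continuous_pow m).mul continuous_const).continuousWithinAt
    exact ((hcont.eventually_lt_const (by simpa using hm)).and self_mem_nhdsWithin).exists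
  have hb0 : 0 < b := one_pos.trans hb1
  have hQψ : ∀ k, Q k ψ ∈ LInftyWeight ψ := fun k => hQ.mapsTo k ψ hQ.weight_mem
  have hterm : ∀ k, b ^ k • Q k ψ ∈ LInftyWeight ψ := fun k =>
    LInftyWeight_smul_mem (hQψ k) _ hψ
  have hterm0 : ∀ k x, 0 ≤ (b ^ k • Q k ψ) x := fun k x =>
    mul_nonneg (by positivity) (hQ.nonneg k ψ hQ.weight_mem (fun y => (hψ y).le) x)
  set φ : E → ℝ := ∑ k ∈ Finset.range m, b ^ k • Q k ψ with hφ
  have hQ0 : Q 0 ψ = ψ := hQ.zero ψ hQ.weight_mem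
  have hshift : b • Q 1 φ + ψ = φ + b ^ m • Q m ψ := by
    rw [hφ, hQ.map_sum 1 _ fun k _ => hterm k, ← Finset.sum_range_succ,
      Finset.sum_range_succ', pow_zero, one_smul, hQ0, Finset.smul_sum]
    congr 1
    refine Finset.sum_congr rfl fun k _ => ?_
    rw [hQ.map_smul 1 _ _ (hQψ k), ← hQ.add 1 k ψ hQ.weight_mem, smul_smul, pow_succ', add_comm]
  refine ⟨φ, b⁻¹, b⁻¹ * (b ^ m * M + 1), LInftyWeight_sum_mem _ (fun k _ => hterm k) hψ,
    fun x => ?_, by positivity, inv_lt_one_of_one_lt₀ hb1, by positivity, fun x => ?_⟩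
  · have h := Finset.single_le_sum (f := fun k => (b ^ k • Q k ψ) x) (fun k _ => hterm0 k x)
      (Finset.mem_range.2 (by omega : 0 < m))
    simpa [hφ, Finset.sum_apply, hQ0] using h
  · have h1 := congrFun hshift x
    simp only [Pi.add_apply, Pi.smul_apply, smul_eq_mul] at h1
    have h2 := hconv m ψ hQ.measurable_weight (fun y => (abs_of_pos (hψ y)).le) x
    have h3 : Q m ψ x ≤ η x * M + ζ m * ψ x := by linarith [le_abs_self (Q m ψ x - η x * M)]
    have h4 : b ^ m * Q m ψ x ≤ b ^ m * (η x * M + ζ m * ψ x) :=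
      mul_le_mul_of_nonneg_left h3 (by positivity)
    have h5 : b ^ m * ζ m * ψ x ≤ 1 * ψ x := mul_le_mul_of_nonneg_right hb.le (hψ x).le
    have h6 : b * Q 1 φ x ≤ φ x + (b ^ m * M + 1) * η x := by nlinarith [hη0 x]
    calc Q 1 φ x = b⁻¹ * (b * Q 1 φ x) := by rw [inv_mul_cancel_left₀ hb0.ne']
      _ ≤ b⁻¹ * (φ x + (b ^ m * M + 1) * η x) := by gcongr
      _ = _ := by ring

end RankOne

/-! ### Condition (G) -/

theorem theorem2p2 {E : Type*} [MeasurableSpace E]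
    (ψ : E → ℝ) (P : ℕ → (E → ℝ) → (E → ℝ)) (hP : IsPositiveSemigroup ψ P)
    (η : E → ℝ) (hη_mem : η ∈ LInftyWeight ψ) (hη_nonneg : ∀ x, 0 ≤ η x) (hη_ne : η ≠ 0)
    (θ₀ : ℝ) (hθ₀ : 0 < θ₀) (hη_eigen : P 1 η = θ₀ • η)
    (νP : Measure E) (hνP : Integrable ψ νP)
    (ζ : ℕ → ℝ) (hζ_pos : ∀ n, 0 < ζ n) (hζ_lim : Tendsto ζ atTop (𝓝 0))
    (hconv : ∀ (n : ℕ) (f : E → ℝ), Measurable f → (∀ x, |f x| ≤ ψ x) →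
      ∀ x, |(θ₀ ^ n)⁻¹ * P n f x - η x * ∫ y, f y ∂νP| ≤ ζ n * ψ x) :
    ∃ ψ₁ : E → ℝ, ψ₁ ∈ LInftyWeight ψ ∧ ψ ∈ LInftyWeight ψ₁ ∧ ConditionG P ψ₁ η := by
  have hψ := hP.weight_pos
  set Q : ℕ → (E → ℝ) → (E → ℝ) := fun n f => (θ₀ ^ n)⁻¹ • P n f with hQdef
  have hQ : IsPositiveSemigroup ψ Q := hP.normalize hθ₀
  have hPQ : ∀ n f x, P n f x = θ₀ ^ n * Q n f x := fun n f x => by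
    simp only [hQdef, Pi.smul_apply, smul_eq_mul]
    rw [mul_inv_cancel_left₀ (by positivity)]
  have hconv' : ∀ n, IsRankOneApprox ψ η νP (Q n) (ζ n) := hconv
  have hfix : Q 1 η = η := by
    simp only [hQdef, hη_eigen, pow_one, smul_smul, inv_mul_cancel₀ hθ₀.ne', one_smul]
  have hη1 := integral_eigenfunction_eq_one hQ hη_mem hη_ne hfix hζ_lim hconv'
  obtain ⟨C, hC0, hC'⟩ := exists_abs_le_of_mem_LInftyWeight hψ hη_mem
  have hC : ∀ x, η x ≤ C * ψ x := fun x => (le_abs_self _).trans (hC' x)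
  set M := ∫ y, ψ y ∂νP with hMdef
  have hM : 0 ≤ M := integral_nonneg fun y => (hψ y).le
  obtain ⟨φ, a, D, hφ_mem, hφ_ge, ha0, ha1, hD0, hφ⟩ :=
    exists_lyapunov_function hQ hζ_lim hη_nonneg hconv'
  obtain ⟨B, hB0, hB⟩ := exists_abs_le_of_mem_LInftyWeight hψ hφ_mem
  -- Scaling the Lyapunov function makes it dominate both `ψ` and `η`.
  set l := max C 1 with hl
  have hl0 : 0 < l := lt_max_of_lt_right one_pos
  set ψ₁ : E → ℝ := l • φ with hψ₁def
  have hφ0 : ∀ x, 0 < φ x := fun x => (hψ x).trans_le (hφ_ge x)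
  have hψ₁0 : ∀ x, 0 < ψ₁ x := fun x => mul_pos hl0 (hφ0 x)
  have hψ₁_ge : ∀ x, ψ x ≤ ψ₁ x := fun x => by
    have : 1 * φ x ≤ l * φ x := mul_le_mul_of_nonneg_right (le_max_right _ _) (hφ0 x).le
    simp only [hψ₁def, Pi.smul_apply, smul_eq_mul]
    linarith [hφ_ge x]
  have hη_le : ∀ x, η x ≤ ψ₁ x := fun x =>
    calc η x ≤ C * ψ x := hC x
      _ ≤ l * φ x := mul_le_mul (le_max_left _ _) (hφ_ge x) (hψ x).le hl0.le
  set R := l * B with hR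
  have hR0 : 0 < R := mul_pos hl0 hB0
  have hψ₁_le : ∀ x, ψ₁ x ≤ R * ψ x := fun x => by
    simp only [hψ₁def, hR, Pi.smul_apply, smul_eq_mul, mul_assoc]
    exact mul_le_mul_of_nonneg_left ((le_abs_self _).trans (hB x)) hl0.le
  have hψ₁_mem : ψ₁ ∈ LInftyWeight ψ := LInftyWeight_smul_mem hφ_mem l hψ
  have hψ_mem₁ : ψ ∈ LInftyWeight ψ₁ :=
    mem_LInftyWeight_of_abs_le hψ₁0 hP.measurable_weight (C := 1) fun x => by
      rw [abs_of_pos (hψ x), one_mul]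
      exact hψ₁_ge x
  have hP₁ : IsPositiveSemigroup ψ₁ P := hP.of_comparable hψ₁0 hψ₁_mem hψ_mem₁
  have hη_mem₁ : η ∈ LInftyWeight ψ₁ :=
    LInftyWeight_subset_of_mem hψ₁0 hψ hψ_mem₁ hη_mem
  set D₁ := l * D with hD₁
  have hD₁0 : 0 < D₁ := mul_pos hl0 hD0
  have hLyap : ∀ x, Q 1 ψ₁ x ≤ a * ψ₁ x + D₁ * η x := fun x => by
    rw [hψ₁def, hQ.map_smul 1 _ _ hφ_mem]
    simp only [Pi.smul_apply, smul_eq_mul]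
    nlinarith [hφ x]
  -- The first bound makes `ψ₁` contract outside `K`, the second one gives `K` positive mass.
  obtain ⟨δ, hδ0, hδ1, hδ2⟩ : ∃ δ : ℝ, 0 < δ ∧ D₁ * δ ≤ (1 - a) / 2 ∧ δ * R * M ≤ 1 / 2 := by
    have ha' : 0 < 1 - a := by linarith
    refine ⟨min ((1 - a) / 2 / D₁) (1 / 2 / (R * M + 1)), by positivity, ?_, ?_⟩
    · exact (le_div_iff₀' hD₁0).1 (min_le_left _ _)
    · have h1 := (le_div_iff₀ (by positivity : 0 < R * M + 1)).1
        (min_le_right ((1 - a) / 2 / D₁) (1 / 2 / (R * M + 1)))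
      have h2 : 0 < min ((1 - a) / 2 / D₁) (1 / 2 / (R * M + 1)) := by positivity
      linarith
  set K : Set E := {x | δ * ψ₁ x ≤ η x} with hKdef
  have hK : MeasurableSet K := measurableSet_le (hψ₁_mem.1.const_mul δ) hη_mem.1
  have hα : 0 < ∫ y in K, ψ y ∂νP := by
    have h1 : ∀ y, η y ≤ C * K.indicator ψ y + δ * R * ψ y := fun y => by
      by_cases hy : y ∈ K
      · rw [Set.indicator_of_mem hy]
        have : 0 ≤ δ * R * ψ y := mul_nonneg (by positivity) (hψ y).le
        linarith [hC y]
      · rw [Set.indicator_of_notMem hy]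
        have h2 : η y < δ * ψ₁ y := not_le.1 hy
        have h3 := mul_le_mul_of_nonneg_left (hψ₁_le y) hδ0.le
        linarith
    have h2 := integral_mono (integrable_of_mem_LInftyWeight hψ hνP hη_mem)
      (((hνP.indicator hK).const_mul C).add (hνP.const_mul (δ * R))) h1
    simp only [Pi.add_apply] at h2
    rw [hη1, integral_add ((hνP.indicator hK).const_mul C) (hνP.const_mul (δ * R)),
      integral_const_mul, integral_const_mul, integral_indicator hK] at h2
    by_contra hneg
    have := mul_nonpos_of_nonneg_of_nonpos hC0.le (not_lt.1 hneg)
    linarith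
  have hK_ne : K.Nonempty := by
    rw [Set.nonempty_iff_ne_empty]
    intro h
    simp [h] at hα
  obtain ⟨n, hn, hn1⟩ : ∃ n, 0 < δ * (∫ y in K, ψ y ∂νP - ζ n * M)
      - ζ n * C * ∫ y in K, ψ y ∂νP ∧ 1 ≤ n := by
    have hlim := (((hζ_lim.mul_const M).const_sub (∫ y in K, ψ y ∂νP)).const_mul δ).sub
      ((hζ_lim.mul_const C).mul_const (∫ y in K, ψ y ∂νP))
    exact ((hlim.eventually_const_lt (by simpa using mul_pos hδ0 hα)).and
      (eventually_ge_atTop 1)).exists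
  obtain ⟨c, ν, hc0, hν_prob, hν_compl, hν⟩ :=
    exists_minorizing_measure hQ hνP hη_mem.1 hη_nonneg hC0 hC hη1 (hconv' n) hδ0 hK hK_ne
      (fun x hx => (mul_le_mul_of_nonneg_left (hψ₁_ge x) hδ0.le).trans hx) hn
  obtain ⟨Z, hZ⟩ := hζ_lim.bddAbove_range
  have hZn : ∀ n, ζ n ≤ Z := fun n => hZ ⟨n, rfl⟩
  have hZ0 : 0 < Z := (hζ_pos 0).trans_le (hZn 0)
  set U := R * (C * M + Z) with hUdef
  have hU0 : 0 < U := by positivity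
  have hupper : ∀ n x, Q n ψ₁ x ≤ U * ψ₁ x := fun n x => by
    have h1 : Q n ψ₁ x ≤ R * Q n ψ x := by
      have := hQ.mono n hψ₁_mem (LInftyWeight_smul_mem hQ.weight_mem R hψ) hψ₁_le x
      rwa [hQ.map_smul n _ _ hQ.weight_mem] at this
    have h2 := (le_abs_self _).trans
      (hconv' n ψ hQ.measurable_weight (fun y => (abs_of_pos (hψ y)).le) x)
    have h3 : Q n ψ x ≤ (C * M + Z) * ψ x := by
      have h4 := mul_le_mul_of_nonneg_right (hC x) hM
      have h5 := mul_le_mul_of_nonneg_right (hZn n) (hψ x).le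
      linarith
    calc Q n ψ₁ x ≤ R * Q n ψ x := h1
      _ ≤ R * ((C * M + Z) * ψ x) := by gcongr
      _ = U * ψ x := by ring
      _ ≤ U * ψ₁ x := mul_le_mul_of_nonneg_left (hψ₁_ge x) hU0.le
  have hlower : ∀ n, ∀ x ∈ K, δ * ψ₁ x ≤ Q n ψ₁ x := fun n x hx => by
    refine le_trans hx ?_
    have := hQ.mono n hη_mem hψ₁_mem hη_le x
    rwa [hQ.map_eigenfunction hη_mem hfix n] at this
  have hind_le : ∀ (n : ℕ) (A : Set E), MeasurableSet A → ∀ x,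
      θ₀ ^ n * Q n (A.indicator ψ) x ≤ P n (A.indicator ψ₁) x := fun n A hA x => by
    rw [← hPQ]
    refine hP.mono n (hP.indicator_mem hA) ?_
      (fun y => Set.indicator_le_indicator (hψ₁_ge y)) x
    exact LInftyWeight_subset_of_mem hψ hψ₁0 hψ₁_mem (hP₁.indicator_mem hA)
  refine ⟨ψ₁, hψ₁_mem, hψ_mem₁, hP₁, hη_mem₁, hη_nonneg, θ₀ * ((1 + a) / 2), θ₀,
    c * θ₀ ^ (n + n) / R, θ₀ * D₁, U / δ, n + n, K, ν, by positivity, hθ₀, by positivity,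
    by positivity, by positivity, by omega, hK, hν_prob, hν_compl, ?_, ⟨?_, ?_, ?_, ?_, ?_⟩,
    ?_, ?_⟩
  · intro x hx A hA hAK
    calc c * θ₀ ^ (n + n) / R * ν.real A * ψ₁ x
        ≤ c * θ₀ ^ (n + n) / R * ν.real A * (R * ψ x) :=
          mul_le_mul_of_nonneg_left (hψ₁_le x) (by positivity)
      _ = θ₀ ^ (n + n) * (c * ν.real A * ψ x) := by field_simp
      _ ≤ θ₀ ^ (n + n) * Q (n + n) (A.indicator ψ) x := by
          gcongr
          exact hν x hx A hA hAK
      _ ≤ _ := hind_le _ A hA x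
  · nlinarith
  · refine (ENNReal.ofReal_pos.2 hδ0).trans_le (le_iInf₂ fun x hx => ?_)
    exact ENNReal.ofReal_le_ofReal ((le_div_iff₀ (hψ₁0 x)).2 hx)
  · refine iSup_le fun x => ?_
    rw [ENNReal.ofReal_le_one]
    exact (div_le_one (hψ₁0 x)).2 (hη_le x)
  · intro x
    rw [hPQ, pow_one]
    have h1 : Q 1 ψ₁ x ≤ (1 + a) / 2 * ψ₁ x + D₁ * K.indicator ψ₁ x := by
      refine (hLyap x).trans ?_
      by_cases hx : x ∈ K
      · rw [Set.indicator_of_mem hx]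
        have h2 := mul_le_mul_of_nonneg_left (hη_le x) hD₁0.le
        nlinarith [hψ₁0 x]
      · rw [Set.indicator_of_notMem hx]
        have h2 := mul_le_mul_of_nonneg_left (not_le.1 hx).le hD₁0.le
        have h3 := mul_le_mul_of_nonneg_right hδ1 (hψ₁0 x).le
        linarith
    calc θ₀ * Q 1 ψ₁ x ≤ θ₀ * ((1 + a) / 2 * ψ₁ x + D₁ * K.indicator ψ₁ x) := by gcongr
      _ = _ := by ring
  · intro x
    rw [hη_eigen]
    exact le_rfl
  · refine iSup_le fun k => ?_
    have hθk : 0 < θ₀ ^ k := pow_pos hθ₀ k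
    have h1 : (⨆ y ∈ K, ENNReal.ofReal (P k ψ₁ y / ψ₁ y)) ≤ ENNReal.ofReal (θ₀ ^ k * U) :=
      iSup₂_le fun y _ => ENNReal.ofReal_le_ofReal <| by
        rw [div_le_iff₀ (hψ₁0 y), hPQ, mul_assoc]
        exact mul_le_mul_of_nonneg_left (hupper k y) hθk.le
    have h2 : ENNReal.ofReal (θ₀ ^ k * δ) ≤ ⨅ y ∈ K, ENNReal.ofReal (P k ψ₁ y / ψ₁ y) :=
      le_iInf₂ fun y hy => ENNReal.ofReal_le_ofReal <| by
        rw [le_div_iff₀ (hψ₁0 y), hPQ, mul_assoc]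
        exact mul_le_mul_of_nonneg_left (hlower k y hy) hθk.le
    refine (ENNReal.div_le_div h1 h2).trans ?_
    rw [← ENNReal.ofReal_div_of_pos (by positivity), mul_div_mul_left _ _ hθk.ne']
  · intro x hx
    have hηx : 0 < η x := (mul_pos hδ0 (hψ₁0 x)).trans_le hx
    have hlim : Tendsto (fun k => η x * ∫ y in K, ψ y ∂νP - ζ k * ψ x) atTop
        (𝓝 (η x * ∫ y in K, ψ y ∂νP - 0 * ψ x)) := (hζ_lim.mul_const (ψ x)).const_sub _
    obtain ⟨N, hN⟩ := eventually_atTop.1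
      (hlim.eventually_const_lt (u := 0) (by simpa using mul_pos hηx hα))
    refine ⟨N, fun k hk => (mul_pos (pow_pos hθ₀ k) ?_).trans_le (hind_le k K hK x)⟩
    have h1 := neg_le_of_abs_le (hconv' k _ (hP.measurable_weight.indicator hK)
      (abs_indicator_le_weight hψ K) x)
    rw [integral_indicator hK] at h1
    linarith [hN k hk]
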